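/- Let $R$ be a unital ring; modules are right $R$-modules. A Gabriel filter on $R$ is a nonempty collection $\mathcal F$ of right ideals such that, writing $(r:I)=\{s\in R \mid rs\in I\}$, (1) $I\in\mathcal F$ and $r\in R$ imply $(r:I)\in\mathcal F$; (2) if $I\in\mathcal F$ and $J$ is a right ideal with $(r:J)\in\mathcal F$ for all $r\in I$, then $J\in\mathcal F$. For a module $M$ let $T_{\mathcal F}(M)=\{m\in M \mid \mathrm{ann}(m)\in\mathcal F\}$; a module $N$ is $\mathcal F$-torsion if $T_{\mathcal F}(N)=N$. The module of quotients $M_{\mathcal F}$ is the largest submodule $N\supseteq M/T_{\mathcal F}(M)$ of the injective envelope of $M/T_{\mathcal F}(M)$ such that $N/(M/T_{\mathcal F}(M))$ is $\mathcal F$-torsion, and $q_{\mathcal F}:M\to M/T_{\mathcal F}(M)\to M_{\mathcal F}$ is the natural map. If $\mathcal F_1\subseteq\mathcal F_2$ are Gabriel filters, $q_{12}:M_{\mathcal F_1}\to M_{\mathcal F_2}$ denotes the unique $R$-linear map with $q_{12}\,q_{\mathcal F_1}=q_{\mathcal F_2}$. A higher derivation on $R$ is a family $\Delta=\{\delta_n\}_{n\ge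 0}$ of additive maps $R\to R$ with $\delta_0=\mathrm{id}$ and $\delta_n(rs)=\sum_{i=0}^n\delta_i(r)\delta_{n-i}(s)$ for all $n$, $r$, $s$. A $\Delta$-higher derivation on a module $M$ is a family $D=\{d_n\}_{n\ge 0}$ of additive maps $M\to M$ with $d_0=\mathrm{id}$ and $d_n(mr)=\sum_{i=0}^n d_i(m)\delta_{n-i}(r)$ for all $n$, $m$, $r$. An extension of $D$ to $M_{\mathcal F}$ is a $\Delta$-higher derivation $D'=\{d'_n\}$ on $M_{\mathcal F}$ with $d'_n q_{\mathcal F}=q_{\mathcal F} d_n$ for all $n$. Let $\Delta$ be a higher derivation on $R$. (a) Let $\mathcal F_1\subseteq\mathcal F_2$ be Gabriel filters on $R$, $M$ a module and $D$ a $\Delta$-higher derivation on $M$. Then $D$ has a unique extension $\{d^{(1)}_n\}$ to $M_{\mathcal F_1}$ and a unique extension $\{d^{(2)}_n\}$ to $M_{\mathcal F_2}$, and these agree: $q_{12}\,d^{(1)}_n=d^{(2)}_n\,q_{12}$ for all $n$. (b) Let $\tau$ be a hereditary torsion theory on right $R$-modules that is faithful (the largest torsion submodule of $R$ is $0$), and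 let $\mathcal F_\tau=\{I \mid R/I \text{ is torsion}\}$ be its Gabriel filter. Let $\mathcal F'$ be the Gabriel filter either of the Lambek torsion theory (torsion modules: those $T$ with $\mathrm{Hom}_R(T,E(R))=0$, where $E(R)$ is the injective envelope of $R$) or of the Goldie torsion theory (torsion-free modules: the nonsingular modules). Then $\mathcal F_\tau\subseteq\mathcal F'$, and for every module $M$ and every $\Delta$-higher derivation $D$ on $M$ the extensions of $D$ to $M_{\mathcal F_\tau}$ and to $M_{\mathcal F'}$ agree in the sense of (a). -/

import Mathlib

/-!
Conventions. Right modules over a ring `R` are `Rᵐᵒᵖ`-modules (`x r` is `MulOpposite.op r • x`) and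
right ideals of `R` are (left) ideals of `Rᵐᵒᵖ`. The general notions below are written for left
modules over a ring `A`; the right-sided notions over `R` are the case `A = Rᵐᵒᵖ`. In particular a
Gabriel filter of right ideals of `R` is an `F : IdealFilter Rᵐᵒᵖ` with `F.IsGabriel`, and
`F₁ ≤ F₂` is inclusion of filters.
-/

universe u v w

/-! ### Essential submodules and injective envelopes -/

section Envelope

/-- A submodule is essential if it meets every nonzero submodule nontrivially. -/
def Submodule.IsEssential {A : Type u} [Ring A] {M : Type v} [AddCommGroup M] [Module A M]
    (P : Submodule A M) : Prop :=
  ∀ Q : Submodule A M, Q ≠ ⊥ → P ⊓ Q ≠ ⊥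

theorem Submodule.isEssential_iff {A : Type u} [Ring A] {M : Type v} [AddCommGroup M] [Module A M]
    (P : Submodule A M) :
    P.IsEssential ↔ ∀ x : M, x ≠ 0 → ∃ a : A, a • x ≠ 0 ∧ a • x ∈ P := by
  constructor
  · intro h x hx
    have h1 := h (Submodule.span A {x}) (by simpa using hx)
    obtain ⟨y, hy, hy0⟩ := Submodule.exists_mem_ne_zero_of_ne_bot h1
    obtain ⟨a, rfl⟩ := Submodule.mem_span_singleton.1 hy.2
    exact ⟨a, hy0, hy.1⟩
  · intro h Q hQ hPQ
    obtain ⟨x, hx, hx0⟩ := Submodule.exists_mem_ne_zero_of_ne_bot hQ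
    obtain ⟨a, ha, haP⟩ := h x hx0
    have : a • x ∈ P ⊓ Q := ⟨haP, Q.smul_mem a hx⟩
    rw [hPQ] at this
    exact ha (by simpa using this)

/-- `ι : N → E` exhibits `E` as an injective envelope of `N`: `E` is an injective module and `ι` is
an essential monomorphism. -/
structure IsInjectiveEnvelope {A : Type u} [Ring A] {N : Type v} [AddCommGroup N] [Module A N]
    {E : Type w} [AddCommGroup E] [Module A E] (ι : N →ₗ[A] E) : Prop where
  mono : Function.Injective ι
  essential : (LinearMap.range ι).IsEssential
  isInjective : Module.Injective A E

theorem exists_injective_embedding (A : Type u) [Ring A] (N : Type v) [AddCommGroup N]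
    [Module A N] :
    ∃ (J : Type (max u v)) (_ : AddCommGroup J) (_ : Module A J) (f : N →ₗ[A] J),
      Module.Injective A J ∧ Function.Injective f := by
  have := ModuleCat.enoughInjectives.{v} A
  let X : ModuleCat.{max u v} A := ModuleCat.of A (ULift.{u} N)
  let J : ModuleCat.{max u v} A := CategoryTheory.Injective.under X
  let f : X ⟶ J := CategoryTheory.Injective.ι X
  have hf : Function.Injective f := (ModuleCat.mono_iff_injective f).1 inferInstance
  have hJ : CategoryTheory.Injective (ModuleCat.of A J) :=
    inferInstanceAs (CategoryTheory.Injective (CategoryTheory.Injective.under X))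
  refine ⟨J, inferInstance, inferInstance,
    f.hom ∘ₗ (ULift.moduleEquiv (R := A) (M := N)).symm.toLinearMap,
    Module.injective_module_of_injective_object A J, ?_⟩
  exact hf.comp (ULift.moduleEquiv (R := A) (M := N)).symm.injective

theorem exists_isInjectiveEnvelope (A : Type u) [Ring A] (N : Type v) [AddCommGroup N]
    [Module A N] :
    ∃ (E : Type (max u v)) (_ : AddCommGroup E) (_ : Module A E) (ι : N →ₗ[A] E),
      IsInjectiveEnvelope ι := by
  obtain ⟨J, _, _, f, hJ, hf⟩ := exists_injective_embedding A N
  let S : Set (Submodule A J) :=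
    {P | ∀ x ∈ P, x ≠ 0 → ∃ a : A, a • x ≠ 0 ∧ a • x ∈ LinearMap.range f}
  obtain ⟨E, hNE, hE⟩ := zorn_le_nonempty₀ S (fun c hc hch y hy => by
      refine ⟨sSup c, ?_, fun z hz => le_sSup hz⟩
      intro x hx hx0
      obtain ⟨P, hP, hxP⟩ := (Submodule.mem_sSup_of_directed ⟨y, hy⟩ hch.directedOn).1 hx
      exact hc hP x hxP hx0) (LinearMap.range f)
    (fun x hx hx0 => ⟨1, by simpa using hx0, by simpa using hx⟩)
  obtain ⟨C, -, hC⟩ := zorn_le_nonempty₀ {C : Submodule A J | ∀ x ∈ C, x ∈ E → x = 0}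
    (fun c hc hch y hy => by
      refine ⟨sSup c, ?_, fun z hz => le_sSup hz⟩
      intro x hx hxE
      obtain ⟨P, hP, hxP⟩ := (Submodule.mem_sSup_of_directed ⟨y, hy⟩ hch.directedOn).1 hx
      exact hc hP x hxP hxE) ⊥ (fun x hx _ => by simpa using hx)
  have hinj : Function.Injective (C.mkQ ∘ₗ E.subtype) := by
    rw [← LinearMap.ker_eq_bot, LinearMap.ker_eq_bot']
    intro x hx
    have : (x : J) ∈ C := by simpa using hx
    exact Subtype.ext (hC.prop _ this x.2)
  obtain ⟨g, hg⟩ := Module.Injective.extension_property A J E (J ⧸ C) (C.mkQ ∘ₗ E.subtype) hinj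
    E.subtype
  have hgE : ∀ x ∈ E, g (C.mkQ x) = x := fun x hx => LinearMap.congr_fun hg ⟨x, hx⟩
  -- `E` is essential in `J ⧸ C`
  have hess : ∀ x : J, x ∉ C → ∃ a : A, ∃ e ∈ E, e ≠ 0 ∧ C.mkQ (a • x) = C.mkQ e := by
    intro x hx
    by_contra hcon
    push Not at hcon
    have hmem : C ⊔ Submodule.span A {x} ∈ {C : Submodule A J | ∀ x ∈ C, x ∈ E → x = 0} := by
      intro y hy hyE
      obtain ⟨c, hc, z, hz, rfl⟩ := Submodule.mem_sup.1 hy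
      obtain ⟨a, rfl⟩ := Submodule.mem_span_singleton.1 hz
      by_contra h0
      refine hcon a _ hyE h0 ?_
      have : C.mkQ c = 0 := by simpa using hc
      rw [map_add, this, zero_add]
    have hle := hC.le_of_ge hmem le_sup_left
    exact hx (hle (Submodule.mem_sup_right (Submodule.mem_span_singleton_self x)))
  have hrange : LinearMap.range g ≤ E := by
    refine hE.le_of_ge ?_ (fun x hx => ⟨C.mkQ x, hgE x hx⟩)
    rintro _ ⟨y, rfl⟩ hy0
    obtain ⟨x, rfl⟩ := C.mkQ_surjective y
    have hxC : x ∉ C := by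
      intro hx
      apply hy0
      have : C.mkQ x = 0 := by simpa using hx
      rw [this, map_zero]
    obtain ⟨a, e, he, he0, hae⟩ := hess x hxC
    obtain ⟨b, hb0, hb⟩ := hE.prop e he he0
    refine ⟨b * a, ?_⟩
    have : (b * a) • g (C.mkQ x) = b • e := by
      rw [mul_smul, ← map_smul g, ← map_smul C.mkQ, hae, hgE e he]
    rw [this]
    exact ⟨hb0, hb⟩
  let r : J →ₗ[A] E := LinearMap.codRestrict E (g ∘ₗ C.mkQ) (fun x => hrange ⟨_, rfl⟩)
  have hr : ∀ x : E, r x = x := fun x => Subtype.ext (hgE x x.2)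
  refine ⟨E, inferInstance, inferInstance,
    LinearMap.codRestrict E f (fun x => hNE ⟨x, rfl⟩), ?_, ?_, ?_⟩
  · intro x y hxy
    exact hf (congrArg Subtype.val hxy)
  · rw [Submodule.isEssential_iff]
    intro x hx
    obtain ⟨a, ha, n, hn⟩ := hE.prop x x.2 (by simpa using hx)
    refine ⟨a, fun h => ha (by simpa using congrArg Subtype.val h), n, Subtype.ext hn⟩
  · constructor
    intro X Y _ _ _ _ i hi k
    obtain ⟨h, hh⟩ := Module.Injective.out i hi (E.subtype ∘ₗ k)
    refine ⟨r ∘ₗ h, fun x => ?_⟩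
    rw [LinearMap.comp_apply, hh]
    exact hr (k x)

variable (A : Type u) [Ring A] (N : Type v) [AddCommGroup N] [Module A N]

/-- The injective envelope `E(N)` of a module `N`. -/
def InjectiveEnvelope : Type (max u v) := (exists_isInjectiveEnvelope A N).choose

noncomputable instance : AddCommGroup (InjectiveEnvelope A N) :=
  (exists_isInjectiveEnvelope A N).choose_spec.choose

noncomputable instance : Module A (InjectiveEnvelope A N) :=
  (exists_isInjectiveEnvelope A N).choose_spec.choose_spec.choose

/-- The embedding of a module in its injective envelope. -/
noncomputable def InjectiveEnvelope.ι : N →ₗ[A] InjectiveEnvelope A N :=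
  (exists_isInjectiveEnvelope A N).choose_spec.choose_spec.choose_spec.choose

theorem InjectiveEnvelope.isInjectiveEnvelope :
    IsInjectiveEnvelope (InjectiveEnvelope.ι A N) :=
  (exists_isInjectiveEnvelope A N).choose_spec.choose_spec.choose_spec.choose_spec

instance : Module.Injective A (InjectiveEnvelope A N) :=
  (InjectiveEnvelope.isInjectiveEnvelope A N).isInjective

end Envelope

/-! ### Torsion submodule and module of quotients of a Gabriel filter -/

namespace IdealFilter

variable {A : Type u} [Ring A]

theorem isTorsionElem_iff (F : IdealFilter A) {M : Type v} [AddCommGroup M] [Module A M] (m : M) :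
    F.IsTorsionElem m ↔ (⊥ : Submodule A M).colon {m} ∈ F := by
  constructor
  · rintro ⟨L, hL, h⟩
    exact Order.PFilter.mem_of_le (fun a ha => by simpa using h a ha) hL
  · intro h
    exact ⟨_, h, fun a ha => by simpa using ha⟩

/-- The largest torsion submodule `T(M)` of `M`, consisting of all `m` with `ann(m) ∈ F`. -/
def torsionSubmodule (F : IdealFilter A) [F.IsGabriel] (M : Type v) [AddCommGroup M]
    [Module A M] : Submodule A M where
  carrier := {m | F.IsTorsionElem m}
  zero_mem' := by
    obtain ⟨L, hL⟩ := F.nonempty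
    exact ⟨L, hL, fun a _ => smul_zero a⟩
  add_mem' := by
    rintro x y ⟨L, hL, hx⟩ ⟨K, hK, hy⟩
    refine ⟨L ⊓ K, F.inf_mem hL hK, fun a ha => ?_⟩
    rw [smul_add, hx a ha.1, hy a ha.2, add_zero]
  smul_mem' := by
    rintro b x ⟨L, hL, hx⟩
    refine ⟨L.colon {b}, IsUniform.colon_mem hL b, fun a ha => ?_⟩
    rw [← mul_smul]
    exact hx _ (by simpa using ha)

variable (F : IdealFilter A) [F.IsGabriel] (M : Type v) [AddCommGroup M] [Module A M]

/-- The torsion-free quotient `M / T(M)` embedded in its injective envelope, as a submodule. -/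
noncomputable def envelopeBase :
    Submodule A (InjectiveEnvelope A (M ⧸ F.torsionSubmodule M)) :=
  LinearMap.range (InjectiveEnvelope.ι A (M ⧸ F.torsionSubmodule M))

/-- The closure of `M / T(M)` in its injective envelope `E`: the largest submodule of `E` which
contains `M / T(M)` and whose quotient by `M / T(M)` is torsion. -/
noncomputable def quotientsSubmodule :
    Submodule A (InjectiveEnvelope A (M ⧸ F.torsionSubmodule M)) :=
  (F.torsionSubmodule (_ ⧸ F.envelopeBase M)).comap (F.envelopeBase M).mkQ

/-- The module of quotients `M_F`. -/
abbrev ModuleOfQuotients : Type (max u v) := F.quotientsSubmodule M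

theorem mem_quotientsSubmodule {x : InjectiveEnvelope A (M ⧸ F.torsionSubmodule M)} :
    x ∈ F.quotientsSubmodule M ↔ ∃ L ∈ F, ∀ a ∈ L, a • x ∈ F.envelopeBase M := by
  change (∃ L ∈ F, ∀ a ∈ L, a • (F.envelopeBase M).mkQ x = 0) ↔ _
  simp only [Submodule.mkQ_apply, ← Submodule.Quotient.mk_smul, Submodule.Quotient.mk_eq_zero]

theorem envelopeBase_le : F.envelopeBase M ≤ F.quotientsSubmodule M := by
  intro x hx
  obtain ⟨L, hL⟩ := F.nonempty
  exact (F.mem_quotientsSubmodule M).2 ⟨L, hL, fun a _ => Submodule.smul_mem _ a hx⟩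

/-- The natural map `q_M : M → M / T(M) → M_F`. -/
noncomputable def toQuotients : M →ₗ[A] F.ModuleOfQuotients M :=
  LinearMap.codRestrict (F.quotientsSubmodule M)
    (InjectiveEnvelope.ι A (M ⧸ F.torsionSubmodule M) ∘ₗ (F.torsionSubmodule M).mkQ)
    (fun x => F.envelopeBase_le M ⟨(F.torsionSubmodule M).mkQ x, rfl⟩)

/-- The envelope of `M / T(M)`, hence also `M_F`, is torsion-free. -/
theorem eq_zero_of_smul_eq_zero {L : Ideal A} (hL : L ∈ F)
    (x : InjectiveEnvelope A (M ⧸ F.torsionSubmodule M)) (hx : ∀ a ∈ L, a • x = 0) : x = 0 := by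
  by_contra h0
  obtain ⟨b, hb0, y, hy⟩ := (Submodule.isEssential_iff _).1
    (InjectiveEnvelope.isInjectiveEnvelope A (M ⧸ F.torsionSubmodule M)).essential x h0
  obtain ⟨m, rfl⟩ := (F.torsionSubmodule M).mkQ_surjective y
  have hm : ∀ a ∈ L.colon {b}, a • m ∈ F.torsionSubmodule M := by
    intro a ha
    have h1 : (a * b) • x = 0 := hx _ (by simpa using ha)
    rw [mul_smul, ← hy, ← map_smul, ← map_smul] at h1
    have h2 := (InjectiveEnvelope.isInjectiveEnvelope A (M ⧸ F.torsionSubmodule M)).mono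
      (h1.trans (map_zero _).symm)
    exact (Submodule.Quotient.mk_eq_zero _).1 h2
  have hmt : m ∈ F.torsionSubmodule M := by
    refine (F.isTorsionElem_iff m).2 (IsGabriel.gabriel_closed _
      ⟨L.colon {b}, IsUniform.colon_mem hL b, fun a ha => ?_⟩)
    refine Order.PFilter.mem_of_le ?_ ((F.isTorsionElem_iff (a • m)).1 (hm a ha))
    intro c hc
    simpa [mul_smul] using hc
  have : (F.torsionSubmodule M).mkQ m = 0 := by simpa using hmt
  rw [this, map_zero] at hy
  exact hb0 hy.symm

variable {F} {F₂ : IdealFilter A} [F₂.IsGabriel]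

theorem torsionSubmodule_mono (h : F ≤ F₂) : F.torsionSubmodule M ≤ F₂.torsionSubmodule M := by
  rintro x ⟨L, hL, hx⟩
  exact ⟨L, h hL, hx⟩

theorem exists_envelope_extension (h : F ≤ F₂) :
    ∃ g : InjectiveEnvelope A (M ⧸ F.torsionSubmodule M) →ₗ[A]
        InjectiveEnvelope A (M ⧸ F₂.torsionSubmodule M),
      g ∘ₗ InjectiveEnvelope.ι A (M ⧸ F.torsionSubmodule M) =
        InjectiveEnvelope.ι A (M ⧸ F₂.torsionSubmodule M) ∘ₗ
          Submodule.factor (torsionSubmodule_mono M h) :=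
  Module.Injective.extension_property A _ _ _ _
    (InjectiveEnvelope.isInjectiveEnvelope A (M ⧸ F.torsionSubmodule M)).mono _

/-- The map `q₁₂ : M_{F₁} → M_{F₂}` induced by an inclusion `F₁ ⊆ F₂`: the restriction of an
extension to the injective envelopes of the projection `M / T₁(M) → M / T₂(M)`. It does not depend
on the chosen extension: see `quotientsMap_comp` and `quotientsMap_unique`. -/
noncomputable def quotientsMap (h : F ≤ F₂) :
    F.ModuleOfQuotients M →ₗ[A] F₂.ModuleOfQuotients M :=
  LinearMap.restrict (exists_envelope_extension M h).choose (by
    intro x hx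
    obtain ⟨L, hL, hLx⟩ := (F.mem_quotientsSubmodule M).1 hx
    refine (F₂.mem_quotientsSubmodule M).2 ⟨L, h hL, fun a ha => ?_⟩
    obtain ⟨y, hy⟩ := hLx a ha
    rw [← map_smul, ← hy]
    exact ⟨_, (LinearMap.congr_fun (exists_envelope_extension M h).choose_spec y).symm⟩)

theorem quotientsMap_comp (h : F ≤ F₂) :
    quotientsMap M h ∘ₗ F.toQuotients M = F₂.toQuotients M := by
  ext m
  exact LinearMap.congr_fun (exists_envelope_extension M h).choose_spec
    ((F.torsionSubmodule M).mkQ m)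

theorem quotientsMap_unique (h : F ≤ F₂) (g : F.ModuleOfQuotients M →ₗ[A] F₂.ModuleOfQuotients M)
    (hg : g ∘ₗ F.toQuotients M = F₂.toQuotients M) : g = quotientsMap M h := by
  ext x : 1
  obtain ⟨L, hL, hLx⟩ := (F.mem_quotientsSubmodule M).1 x.2
  rw [← sub_eq_zero]
  refine Subtype.ext (F₂.eq_zero_of_smul_eq_zero M (h hL) _ fun a ha => ?_)
  obtain ⟨y, hy⟩ := hLx a ha
  obtain ⟨m, rfl⟩ := (F.torsionSubmodule M).mkQ_surjective y
  have hm : a • x = F.toQuotients M m := Subtype.ext hy.symm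
  have h1 : a • g x = a • quotientsMap M h x := by
    rw [← map_smul, ← map_smul, hm, ← LinearMap.comp_apply, ← LinearMap.comp_apply, hg,
      quotientsMap_comp]
  have h2 : a • (g x - quotientsMap M h x) = 0 := by rw [smul_sub, h1, sub_self]
  exact congrArg Subtype.val h2

end IdealFilter

/-! ### Torsion theories -/

/-- A torsion theory: a pair of classes of modules, each of which is maximal with respect to
`Hom(T, F) = 0` for `T` torsion and `F` torsion-free. -/
structure TorsionTheory (A : Type u) [Ring A] where
  IsTorsion : ∀ (M : Type u) [AddCommGroup M] [Module A M], Prop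
  IsTorsionFree : ∀ (M : Type u) [AddCommGroup M] [Module A M], Prop
  isTorsion_iff : ∀ (M : Type u) [AddCommGroup M] [Module A M], IsTorsion M ↔
    ∀ (N : Type u) [AddCommGroup N] [Module A N], IsTorsionFree N → ∀ f : M →ₗ[A] N, f = 0
  isTorsionFree_iff : ∀ (N : Type u) [AddCommGroup N] [Module A N], IsTorsionFree N ↔
    ∀ (M : Type u) [AddCommGroup M] [Module A M], IsTorsion M → ∀ f : M →ₗ[A] N, f = 0

/-- A torsion theory is hereditary if submodules of torsion modules are torsion. -/
structure HereditaryTorsionTheory (A : Type u) [Ring A] extends TorsionTheory A where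
  hereditary : ∀ (M : Type u) [AddCommGroup M] [Module A M] (N : Submodule A M),
    IsTorsion M → IsTorsion N

namespace TorsionTheory

variable {A : Type u} [Ring A] (τ : TorsionTheory A)

/-- The largest torsion submodule `T(M)`: the sum of all torsion submodules. -/
def torsionPart (M : Type u) [AddCommGroup M] [Module A M] : Submodule A M :=
  sSup {N : Submodule A M | τ.IsTorsion N}

/-- A torsion theory is faithful if `T(A) = 0`. -/
def IsFaithful : Prop := τ.torsionPart A = ⊥

end TorsionTheory

namespace HereditaryTorsionTheory

variable {A : Type u} [Ring A] (τ : HereditaryTorsionTheory A)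

theorem isTorsion_of_injective {M N : Type u} [AddCommGroup M] [Module A M] [AddCommGroup N]
    [Module A N] (g : M →ₗ[A] N) (hg : Function.Injective g) (hN : τ.IsTorsion N) :
    τ.IsTorsion M := by
  have h := (τ.isTorsion_iff _).1 (τ.hereditary N (LinearMap.range g) hN)
  refine (τ.isTorsion_iff M).2 fun P _ _ hP f => ?_
  have h0 := h P hP (f ∘ₗ (LinearEquiv.ofInjective g hg).symm.toLinearMap)
  ext x
  simpa using LinearMap.congr_fun h0 (LinearEquiv.ofInjective g hg x)

/-- The map `A ⧸ (I : a) → A ⧸ I` induced by right multiplication by `a`. -/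
theorem exists_colon_map (I : Ideal A) (a : A) :
    ∃ g : (A ⧸ I.colon {a}) →ₗ[A] (A ⧸ I), Function.Injective g ∧
      ∀ b : A, g (Submodule.Quotient.mk b) = Submodule.Quotient.mk (b * a) := by
  refine ⟨Submodule.mapQ _ _ (LinearMap.toSpanSingleton A A a)
    (fun b hb => by simpa using hb), ?_, fun b => rfl⟩
  rw [← LinearMap.ker_eq_bot, LinearMap.ker_eq_bot']
  intro x hx
  obtain ⟨b, rfl⟩ := Submodule.Quotient.mk_surjective _ x
  have : (Submodule.Quotient.mk (b * a) : A ⧸ I) = 0 := hx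
  rw [Submodule.Quotient.mk_eq_zero] at this ⊢
  simpa using this

theorem colon_mem (I : Ideal A) (hI : τ.IsTorsion (A ⧸ I)) (a : A) :
    τ.IsTorsion (A ⧸ I.colon {a}) := by
  obtain ⟨g, hg, -⟩ := exists_colon_map I a
  exact τ.isTorsion_of_injective g hg hI

theorem gabriel_mem (I J : Ideal A) (hJ : τ.IsTorsion (A ⧸ J))
    (h : ∀ a ∈ J, τ.IsTorsion (A ⧸ I.colon {a})) : τ.IsTorsion (A ⧸ I) := by
  refine (τ.isTorsion_iff _).2 fun N _ _ hN f => ?_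
  have h1 : ∀ a ∈ J, f (Submodule.Quotient.mk a) = 0 := by
    intro a ha
    obtain ⟨g, -, hg⟩ := exists_colon_map I a
    have h2 := (τ.isTorsion_iff _).1 (h a ha) N hN (f ∘ₗ g)
    have h3 := LinearMap.congr_fun h2 (Submodule.Quotient.mk 1)
    rw [LinearMap.comp_apply, hg, one_mul] at h3
    exact h3
  have h4 := (τ.isTorsion_iff _).1 hJ N hN (Submodule.liftQ J (f ∘ₗ I.mkQ) (fun a ha => h1 a ha))
  ext
  exact LinearMap.congr_fun h4 (Submodule.Quotient.mk 1)

theorem top_mem : τ.IsTorsion (A ⧸ (⊤ : Ideal A)) := by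
  refine (τ.isTorsion_iff _).2 fun N _ _ _ f => ?_
  ext
  have : (Submodule.Quotient.mk (1 : A) : A ⧸ (⊤ : Ideal A)) = 0 := by
    rw [Submodule.Quotient.mk_eq_zero]; trivial
  change f (Submodule.Quotient.mk 1) = 0
  rw [this, map_zero]

/-- The filter `{I | A / I is torsion}` of a hereditary torsion theory. -/
def filter : IdealFilter A :=
  (Order.IsPFilter.of_def (F := {I : Ideal A | τ.IsTorsion (A ⧸ I)}) ⟨⊤, τ.top_mem⟩
    (fun I hI J hJ => ⟨I ⊓ J, τ.gabriel_mem _ I hI fun a ha => by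
      have : (I ⊓ J).colon {a} = J.colon {a} := by
        ext b
        simp only [Submodule.mem_colon_singleton, Submodule.mem_inf, and_iff_right_iff_imp]
        exact fun _ => I.smul_mem b ha
      change τ.IsTorsion _
      rw [this]
      exact τ.colon_mem J hJ a, inf_le_left, inf_le_right⟩)
    (fun {I J} hIJ hI => τ.gabriel_mem J I hI fun a ha => by
      have : J.colon {a} = ⊤ := by
        ext b
        simpa using J.smul_mem b (hIJ ha)
      rw [this]
      exact τ.top_mem)).toPFilter

theorem mem_filter (I : Ideal A) : I ∈ τ.filter ↔ τ.IsTorsion (A ⧸ I) := Iff.rfl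

instance : τ.filter.IsGabriel where
  colon_mem hI a := τ.colon_mem _ hI a
  gabriel_closed I := fun ⟨J, hJ, h⟩ => τ.gabriel_mem I J hJ h

/-- The Lambek torsion theory, cogenerated by the injective envelope of the ring: `M` is torsion
iff `Hom(M, E(A)) = 0`. -/
def lambek (A : Type u) [Ring A] : HereditaryTorsionTheory A where
  IsTorsion M _ _ := ∀ f : M →ₗ[A] InjectiveEnvelope A A, f = 0
  IsTorsionFree N _ _ := ∀ (M : Type u) [AddCommGroup M] [Module A M],
    (∀ f : M →ₗ[A] InjectiveEnvelope A A, f = 0) → ∀ f : M →ₗ[A] N, f = 0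
  isTorsion_iff M _ _ := ⟨fun h _ _ _ hN f => hN M h f, fun h f => h _ (fun _ _ _ h' => h') f⟩
  isTorsionFree_iff _ _ _ := Iff.rfl
  hereditary M _ _ N hM f := by
    obtain ⟨g, hg⟩ := Module.Injective.extension_property A (InjectiveEnvelope A A) N M
      N.subtype N.injective_subtype f
    rw [← hg, hM g, LinearMap.zero_comp]

end HereditaryTorsionTheory

/-- A module is nonsingular if no nonzero element has an essential annihilator. -/
def IsNonsingularModule (A : Type u) [Ring A] (M : Type v) [AddCommGroup M] [Module A M] : Prop :=
  ∀ m : M, ((⊥ : Submodule A M).colon {m}).IsEssential → m = 0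

theorem IsNonsingularModule.envelope {A : Type u} [Ring A] {N : Type v} [AddCommGroup N]
    [Module A N] (hN : IsNonsingularModule A N) :
    IsNonsingularModule A (InjectiveEnvelope A N) := by
  intro x hx
  by_contra h0
  have hE := InjectiveEnvelope.isInjectiveEnvelope A N
  obtain ⟨b, hb0, n, hn⟩ := (Submodule.isEssential_iff _).1 hE.essential x h0
  have : n = 0 := by
    apply hN
    rw [Submodule.isEssential_iff] at hx ⊢
    have key : ∀ c : A, c • n = 0 ↔ (c * b) • x = 0 := by
      intro c
      rw [mul_smul, ← hn, ← map_smul, map_eq_zero_iff _ hE.mono]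
    intro a ha
    by_cases hab : a * b = 0
    · refine ⟨1, by simpa using ha, ?_⟩
      simp [key, hab]
    · obtain ⟨c, hc0, hc⟩ := hx (a * b) hab
      refine ⟨c, fun h => hc0 ?_, ?_⟩
      · simp only [smul_eq_mul] at h ⊢
        rw [← mul_assoc, h, zero_mul]
      · simpa [key, mul_assoc] using hc
  rw [this, map_zero] at hn
  exact hb0 hn.symm

/-- The Goldie torsion theory, whose torsion-free modules are the nonsingular modules. -/
def HereditaryTorsionTheory.goldie (A : Type u) [Ring A] : HereditaryTorsionTheory A where
  IsTorsion M _ _ := ∀ (N : Type u) [AddCommGroup N] [Module A N], IsNonsingularModule A N →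
    ∀ f : M →ₗ[A] N, f = 0
  IsTorsionFree N _ _ := IsNonsingularModule A N
  isTorsion_iff _ _ _ := Iff.rfl
  isTorsionFree_iff N _ _ := by
    refine ⟨fun hN M _ _ hM f => hM N hN f, fun h n hn => ?_⟩
    let I : Ideal A := (⊥ : Submodule A N).colon {n}
    let g : (A ⧸ I) →ₗ[A] N :=
      Submodule.liftQ I (LinearMap.toSpanSingleton A N n) (fun a ha => by simpa [I] using ha)
    have hg : g = 0 := by
      refine h (A ⧸ I) (fun P _ _ hP f => ?_) g
      ext
      refine hP _ ?_
      rw [Submodule.isEssential_iff] at hn ⊢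
      intro a ha
      obtain ⟨c, hc0, hc⟩ := hn a ha
      refine ⟨c, hc0, ?_⟩
      rw [Submodule.mem_colon_singleton]
      change (c • a) • f (Submodule.Quotient.mk 1) = 0
      rw [← map_smul, ← Submodule.Quotient.mk_smul, smul_eq_mul, mul_one,
        (Submodule.Quotient.mk_eq_zero I).2 hc, map_zero]
    simpa [g] using LinearMap.congr_fun hg (Submodule.Quotient.mk 1)
  hereditary M _ _ K hM N _ _ hN f := by
    obtain ⟨g, hg⟩ := Module.Injective.extension_property A (InjectiveEnvelope A N) K M
      K.subtype K.injective_subtype (InjectiveEnvelope.ι A N ∘ₗ f)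
    rw [hM _ hN.envelope g, LinearMap.zero_comp] at hg
    ext x
    exact (InjectiveEnvelope.isInjectiveEnvelope A N).mono
      ((LinearMap.congr_fun hg x).symm.trans (map_zero _).symm)

/-! ### Higher derivations -/

/-- A higher derivation `Δ = {δₙ}` on a ring `R`. -/
structure HigherDerivation (R : Type u) [Ring R] where
  δ : ℕ → R →+ R
  zero_eq : δ 0 = AddMonoidHom.id R
  map_mul : ∀ (n : ℕ) (r s : R),
    δ n (r * s) = ∑ i ∈ Finset.range (n + 1), δ i r * δ (n - i) s

/-- A `Δ`-higher derivation `D = {dₙ}` on a right `R`-module `M`: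
`dₙ(m r) = ∑_{i ≤ n} dᵢ(m) δₙ₋ᵢ(r)` and `d₀ = id`. -/
structure HigherDerivation.OnModule {R : Type u} [Ring R] (Δ : HigherDerivation R) (M : Type v)
    [AddCommGroup M] [Module Rᵐᵒᵖ M] where
  d : ℕ → M →+ M
  zero_eq : d 0 = AddMonoidHom.id M
  map_smul : ∀ (n : ℕ) (m : M) (r : R), d n (MulOpposite.op r • m) =
    ∑ i ∈ Finset.range (n + 1), MulOpposite.op (Δ.δ (n - i) r) • d i m

namespace HigherDerivation.OnModule

variable {R : Type u} [Ring R] {Δ : HigherDerivation R} {M : Type v} [AddCommGroup M]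
  [Module Rᵐᵒᵖ M]

/-- `D'` on `M_F` extends `D` on `M`: `d'ₙ q_M = q_M dₙ` for all `n`. -/
def IsExtension (F : IdealFilter Rᵐᵒᵖ) [F.IsGabriel] (D : Δ.OnModule M)
    (D' : Δ.OnModule (F.ModuleOfQuotients M)) : Prop :=
  ∀ (n : ℕ) (m : M), D'.d n (F.toQuotients M m) = F.toQuotients M (D.d n m)

/-- The extensions of `D` to `M_{F₁}` and `M_{F₂}` agree: `D` has a unique extension to each of the
two modules of quotients, and these extensions commute with `q₁₂ : M_{F₁} → M_{F₂}`. -/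
def ExtensionsAgree {F₁ F₂ : IdealFilter Rᵐᵒᵖ} [F₁.IsGabriel] [F₂.IsGabriel] (h : F₁ ≤ F₂)
    (D : Δ.OnModule M) : Prop :=
  (∃! D₁ : Δ.OnModule (F₁.ModuleOfQuotients M), D.IsExtension F₁ D₁) ∧
  (∃! D₂ : Δ.OnModule (F₂.ModuleOfQuotients M), D.IsExtension F₂ D₂) ∧
  ∀ (D₁ : Δ.OnModule (F₁.ModuleOfQuotients M)) (D₂ : Δ.OnModule (F₂.ModuleOfQuotients M)),
    D.IsExtension F₁ D₁ → D.IsExtension F₂ D₂ →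
    ∀ (n : ℕ) (x : F₁.ModuleOfQuotients M),
      IdealFilter.quotientsMap M h (D₁.d n x) = D₂.d n (IdealFilter.quotientsMap M h x)

end HigherDerivation.OnModule

/-! A higher derivation `Δ` on `R` amounts to a ring homomorphism `r ↦ ∑ δₙ(r) tⁿ` from `R` to
`R[[t]]` lifting the identity. Through it, series with coefficients in a module `N` form a right
`R`-module `Δ.Series N`, and a `Δ`-higher derivation on `M` is the same thing as an `R`-linear map
`M → Δ.Series M` that is a section of the constant coefficient (`toSeries`, `ofSeries`). Questions
about extending higher derivations thus become questions about extending linear maps.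

The module `M_F` is closed: torsion-free and `F`-injective. Linear maps from `M` to a closed module
extend to `M_F` (`exists_lift`), and extensions into a torsion-free module are unique
(`IsTorsionFree.hom_ext`). The crucial point is that `Δ.Series N` is closed when `N` is
(`Series.isTorsionFree`, `Series.isFilterInjective`); this is proved one coefficient at a time,
because the lowest coefficient of a series transforms linearly. Existence and uniqueness of the
extension follow with `N = M_F`. Agreement follows since both composites `M_{F₁} → Δ.Series M_{F₂}`
coincide on `M` and the target is `F₁`-torsion-free.

For (b) only the inclusions of filters remain. Faithfulness makes the ring torsion-free for
`τ.filter`, and both inclusions come from that. -/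

/-! ### Closed modules with respect to a Gabriel filter -/

namespace IdealFilter

variable {A : Type u} [Ring A]

/-- A module is torsion-free for a filter of ideals if no nonzero element is killed by a member of
the filter. -/
def IsTorsionFree (F : IdealFilter A) (N : Type w) [AddCommGroup N] [Module A N] : Prop :=
  ∀ L ∈ F, ∀ x : N, (∀ a ∈ L, a • x = 0) → x = 0

/-- A module is `F`-injective if every linear map on a member of `F` is given by an element. -/
def IsFilterInjective (F : IdealFilter A) (N : Type w) [AddCommGroup N] [Module A N] : Prop :=
  ∀ L ∈ F, ∀ f : L →ₗ[A] N, ∃ y : N, ∀ a : L, f a = (a : A) • y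

theorem IsTorsionFree.anti {F G : IdealFilter A} (h : F ≤ G) {N : Type w} [AddCommGroup N]
    [Module A N] (hN : G.IsTorsionFree N) : F.IsTorsionFree N :=
  fun L hL => hN L (h hL)

variable (F : IdealFilter A) [F.IsGabriel] (M : Type v) [AddCommGroup M] [Module A M]

theorem isTorsionFree_moduleOfQuotients : F.IsTorsionFree (F.ModuleOfQuotients M) :=
  fun _ hL x hx => Subtype.ext (F.eq_zero_of_smul_eq_zero M hL x
    fun a ha => congrArg Subtype.val (hx a ha))

/-- Injectivity of the envelope provides an element `y` of it representing `f`. Each `a • y` with `a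
∈ L` lies in `M_F`, so `y` is torsion modulo `M_F`; the second Gabriel axiom then puts `y` itself in
`M_F`. -/
theorem isFilterInjective_moduleOfQuotients : F.IsFilterInjective (F.ModuleOfQuotients M) := by
  intro L hL f
  obtain ⟨g, hg⟩ := Module.Injective.extension_property A
    (InjectiveEnvelope A (M ⧸ F.torsionSubmodule M)) L A L.subtype L.injective_subtype
    ((F.quotientsSubmodule M).subtype ∘ₗ f)
  have hga : ∀ a : L, (a : A) • g 1 = f a := fun a => by
    rw [← map_smul, smul_eq_mul, mul_one]
    exact LinearMap.congr_fun hg a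
  have hmem : g 1 ∈ F.quotientsSubmodule M := by
    refine (F.mem_quotientsSubmodule M).2 ⟨(F.envelopeBase M).colon {g 1},
      IsGabriel.gabriel_closed _ ⟨L, hL, fun a ha => ?_⟩, fun a ha => by simpa using ha⟩
    obtain ⟨K, hK, hKa⟩ := (F.mem_quotientsSubmodule M).1 (f ⟨a, ha⟩).2
    refine Order.PFilter.mem_of_le (fun b hb => ?_) hK
    have := hKa b hb
    rw [← hga ⟨a, ha⟩, ← mul_smul] at this
    simpa using this
  exact ⟨⟨g 1, hmem⟩, fun a => Subtype.ext (hga a).symm⟩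

theorem exists_smul_eq_toQuotients (x : F.ModuleOfQuotients M) :
    ∃ L ∈ F, ∀ a ∈ L, ∃ m, a • x = F.toQuotients M m := by
  obtain ⟨L, hL, h⟩ := (F.mem_quotientsSubmodule M).1 x.2
  refine ⟨L, hL, fun a ha => ?_⟩
  obtain ⟨y, hy⟩ := h a ha
  obtain ⟨m, rfl⟩ := (F.torsionSubmodule M).mkQ_surjective y
  exact ⟨m, Subtype.ext hy.symm⟩

theorem toQuotients_eq_zero_iff (m : M) :
    F.toQuotients M m = 0 ↔ m ∈ F.torsionSubmodule M := by
  have : F.toQuotients M m = 0 ↔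
      InjectiveEnvelope.ι A (M ⧸ F.torsionSubmodule M) ((F.torsionSubmodule M).mkQ m) = 0 :=
    Subtype.ext_iff
  rw [this, map_eq_zero_iff _ (InjectiveEnvelope.isInjectiveEnvelope A _).mono]
  simp

variable {F M} {N : Type w} [AddCommGroup N] [Module A N]

/-- Linear maps from `M_F` to a torsion-free module are determined by their restriction to `M`. -/
theorem IsTorsionFree.hom_ext (hN : F.IsTorsionFree N) {f g : F.ModuleOfQuotients M →ₗ[A] N}
    (h : ∀ m, f (F.toQuotients M m) = g (F.toQuotients M m)) : f = g := by
  ext x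
  obtain ⟨L, hL, hLx⟩ := F.exists_smul_eq_toQuotients M x
  rw [← sub_eq_zero]
  refine hN L hL _ fun a ha => ?_
  obtain ⟨m, hm⟩ := hLx a ha
  rw [smul_sub, ← map_smul, ← map_smul, hm, h, sub_self]

/-- The kernel of `F.toQuotients M` is the torsion submodule, which every map to a torsion-free
module kills. Values of `g` may therefore be computed from any preimage in `M`. -/
theorem IsTorsionFree.map_eq_of_toQuotients_eq (hN : F.IsTorsionFree N) (g : M →ₗ[A] N) {m m' : M}
    (h : F.toQuotients M m = F.toQuotients M m') : g m = g m' := by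
  rw [← sub_eq_zero, ← map_sub, toQuotients_eq_zero_iff] at h
  obtain ⟨L, hL, hLm⟩ := h
  rw [← sub_eq_zero, ← map_sub]
  exact hN L hL _ fun a ha => by rw [← map_smul, hLm a ha, map_zero]

/-- A linear map from `M` to a torsion-free `F`-injective module extends to `M_F`. -/
theorem exists_lift (hN : F.IsTorsionFree N) (hN' : F.IsFilterInjective N) (g : M →ₗ[A] N) :
    ∃ f : F.ModuleOfQuotients M →ₗ[A] N, ∀ m, f (F.toQuotients M m) = g m := by
  -- The graph of the lift: `y` is the value at `x` when, for all `a` in some member of `F`, `a • x`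
  -- comes from an `m` with `a • y = g m`. Torsion-freeness makes `y` unique and `F`-injectivity
  -- makes it exist; linearity then follows from uniqueness.
  let P : F.ModuleOfQuotients M → N → Prop := fun x y =>
    ∃ L ∈ F, ∀ a ∈ L, ∃ m, a • x = F.toQuotients M m ∧ a • y = g m
  have huniq : ∀ x y y', P x y → P x y' → y = y' := by
    rintro x y y' ⟨L, hL, h⟩ ⟨L', hL', h'⟩
    rw [← sub_eq_zero]
    refine hN _ (F.inf_mem hL hL') _ fun a ha => ?_
    obtain ⟨m, hm, hy⟩ := h a ha.1
    obtain ⟨m', hm', hy'⟩ := h' a ha.2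
    rw [smul_sub, hy, hy', hN.map_eq_of_toQuotients_eq g (hm.symm.trans hm'), sub_self]
  have hex : ∀ x, ∃ y, P x y := by
    intro x
    obtain ⟨L, hL, h⟩ := F.exists_smul_eq_toQuotients M x
    choose! m hm using h
    obtain ⟨y, hy⟩ := hN' L hL
      { toFun := fun a => g (m a)
        map_add' := fun a b => by
          rw [← map_add]
          refine hN.map_eq_of_toQuotients_eq g ?_
          rw [map_add, ← hm a a.2, ← hm b b.2, ← hm _ (a + b).2, ← add_smul]
          rfl
        map_smul' := fun c a => by
          rw [RingHom.id_apply, ← map_smul]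
          refine hN.map_eq_of_toQuotients_eq g ?_
          rw [map_smul, ← hm a a.2, ← hm _ (c • a).2, ← mul_smul]
          rfl }
    exact ⟨y, L, hL, fun a ha => ⟨m a, hm a ha, (hy ⟨a, ha⟩).symm⟩⟩
  choose f hf using hex
  refine ⟨{ toFun := f, map_add' := fun x y => ?_, map_smul' := fun c x => ?_ }, fun m => ?_⟩
  · refine huniq _ _ _ (hf _) ?_
    obtain ⟨L, hL, h⟩ := hf x
    obtain ⟨K, hK, h'⟩ := hf y
    refine ⟨L ⊓ K, F.inf_mem hL hK, fun a ha => ?_⟩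
    obtain ⟨m, hm, hy⟩ := h a ha.1
    obtain ⟨m', hm', hy'⟩ := h' a ha.2
    exact ⟨m + m', by rw [smul_add, hm, hm', map_add], by rw [smul_add, hy, hy', map_add]⟩
  · refine huniq _ _ _ (hf _) ?_
    obtain ⟨L, hL, h⟩ := hf x
    refine ⟨L.colon {c}, IsUniform.colon_mem hL c, fun a ha => ?_⟩
    obtain ⟨m, hm, hy⟩ := h (a * c) (by simpa using ha)
    exact ⟨m, by rw [← mul_smul, hm], by rw [RingHom.id_apply, ← mul_smul, hy]⟩
  · refine huniq _ _ _ (hf _) ?_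
    obtain ⟨L, hL⟩ := F.nonempty
    exact ⟨L, hL, fun a _ => ⟨a • m, by rw [map_smul], by rw [map_smul]⟩⟩

end IdealFilter

/-! ### Formal series with coefficients in a module, twisted by a higher derivation -/

namespace HigherDerivation

open MulOpposite

variable {R : Type u} [Ring R] (Δ : HigherDerivation R)

theorem δ_zero_apply (r : R) : Δ.δ 0 r = r := by rw [Δ.zero_eq]; rfl

/-- In the expansion of `δₙ₊₁(1 * 1)` the inner terms vanish by induction and the two end terms are
both `δₙ₊₁(1)`, so `δₙ₊₁(1)` equals its own double. -/
theorem δ_one (n : ℕ) : Δ.δ (n + 1) 1 = 0 := by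
  induction n using Nat.strong_induction_on with
  | _ n ih =>
    have h := Δ.map_mul (n + 1) 1 1
    rw [mul_one, Finset.sum_range_succ, Finset.sum_range_succ'] at h
    rw [Finset.sum_eq_zero fun i hi => by rw [ih i (Finset.mem_range.1 hi), zero_mul]] at h
    simpa [δ_zero_apply] using h

/-- Sequences in a right `R`-module `N`, thought of as formal series `∑ yₙ tⁿ`, on which `r` acts as
multiplication by `∑ δₙ(r) tⁿ`. -/
def Series (_ : HigherDerivation R) (N : Type w) : Type w := ℕ → N

namespace Series

variable {Δ} {N : Type w} [AddCommGroup N]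

instance : AddCommGroup (Δ.Series N) := inferInstanceAs (AddCommGroup (ℕ → N))

/-- The coefficients of a series. -/
def coeff (n : ℕ) : Δ.Series N →+ N := Pi.evalAddMonoidHom (fun _ => N) n

@[ext] theorem ext {x y : Δ.Series N} (h : ∀ n, coeff n x = coeff n y) : x = y := funext h

/-- The series with given coefficients. -/
def mk (f : ℕ → N) : Δ.Series N := f

@[simp] theorem coeff_mk (f : ℕ → N) (n : ℕ) : coeff n (mk f : Δ.Series N) = f n := rfl

variable [Module Rᵐᵒᵖ N]

instance : SMul Rᵐᵒᵖ (Δ.Series N) where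
  smul a y := mk fun n => ∑ i ∈ Finset.range (n + 1), op (Δ.δ (n - i) a.unop) • coeff i y

theorem coeff_smul (a : Rᵐᵒᵖ) (y : Δ.Series N) (n : ℕ) :
    coeff n (a • y) = ∑ i ∈ Finset.range (n + 1), op (Δ.δ (n - i) a.unop) • coeff i y := rfl

instance : Module Rᵐᵒᵖ (Δ.Series N) where
  one_smul y := by
    ext n
    rw [coeff_smul, Finset.sum_range_succ, Finset.sum_eq_zero]
    · simp [δ_zero_apply]
    · intro i hi
      obtain ⟨k, hk⟩ := Nat.exists_eq_add_of_lt (Finset.mem_range.1 hi)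
      rw [show n - i = k + 1 by omega, unop_one, δ_one, op_zero, zero_smul]
  mul_smul a b y := by
    ext n
    simp only [coeff_smul, unop_mul, Δ.map_mul, Finset.op_sum, Finset.sum_smul, Finset.smul_sum,
      op_mul, mul_smul]
    rw [Finset.sum_sigma', Finset.sum_sigma']
    -- Both sides sum `δₚ(a) δ_q(b) yᵢ`, suitably read on the right, over `p + q + i = n`: the left
    -- is indexed by `(i, q)`, the right by `(i + q, i)`.
    refine Finset.sum_nbij' (fun p => ⟨p.1 + p.2, p.1⟩) (fun p => ⟨p.2, p.1 - p.2⟩) ?_ ?_ ?_ ?_ ?_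
    · rintro ⟨i, j⟩ h
      simp only [Finset.mem_sigma, Finset.mem_range] at h ⊢
      omega
    · rintro ⟨i, j⟩ h
      simp only [Finset.mem_sigma, Finset.mem_range] at h ⊢
      omega
    · rintro ⟨i, j⟩ h
      simp
    · rintro ⟨i, j⟩ h
      simp only [Finset.mem_sigma, Finset.mem_range] at h
      simp only [Sigma.mk.injEq, heq_eq_eq, and_true]
      omega
    · rintro ⟨i, j⟩ h
      simp [Nat.sub_sub]
  smul_zero a := by ext n; simp [coeff_smul]
  smul_add a x y := by ext n; simp [coeff_smul, Finset.sum_add_distrib]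
  add_smul a b y := by ext n; simp [coeff_smul, Finset.sum_add_distrib, add_smul]
  zero_smul y := by ext n; simp [coeff_smul]

/-- On series of order at least `n`, the `n`-th coefficient is linear. -/
theorem coeff_smul_of_order (a : Rᵐᵒᵖ) (y : Δ.Series N) (n : ℕ) (h : ∀ i < n, coeff i y = 0) :
    coeff n (a • y) = a • coeff n y := by
  rw [coeff_smul, Finset.sum_range_succ, Finset.sum_eq_zero, zero_add, Nat.sub_self, δ_zero_apply,
    op_unop]
  exact fun i hi => by rw [h i (Finset.mem_range.1 hi), smul_zero]

theorem coeff_smul_congr (a : Rᵐᵒᵖ) {x y : Δ.Series N} {n : ℕ}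
    (h : ∀ i ≤ n, coeff i x = coeff i y) : coeff n (a • x) = coeff n (a • y) := by
  rw [coeff_smul, coeff_smul]
  exact Finset.sum_congr rfl fun i hi => by rw [h i (Nat.lt_succ_iff.1 (Finset.mem_range.1 hi))]

/-- The constant coefficient as a linear map. -/
def constantCoeff : Δ.Series N →ₗ[Rᵐᵒᵖ] N where
  __ := coeff 0
  map_smul' a y := coeff_smul_of_order a y 0 (by simp)

/-- A linear map acts coefficientwise on series. -/
def map {N' : Type*} [AddCommGroup N'] [Module Rᵐᵒᵖ N'] (f : N →ₗ[Rᵐᵒᵖ] N') :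
    Δ.Series N →ₗ[Rᵐᵒᵖ] Δ.Series N' where
  toFun y := mk fun n => f (coeff n y)
  map_add' x y := by ext n; simp
  map_smul' a y := by ext n; simp [coeff_smul]

variable {F : IdealFilter Rᵐᵒᵖ}

/-- The coefficients below `n` of a series are determined by those of its multiples by a member of
the filter. -/
theorem coeff_eq_zero_of_smul (hN : F.IsTorsionFree N) {L : Ideal Rᵐᵒᵖ} (hL : L ∈ F)
    {y : Δ.Series N} {n : ℕ} (h : ∀ a ∈ L, ∀ i < n, coeff i (a • y) = 0) :
    ∀ i < n, coeff i y = 0 := by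
  intro i
  induction i using Nat.strong_induction_on with
  | _ i ih =>
    intro hi
    refine hN L hL _ fun a ha => ?_
    -- By induction `y` has order at least `i`, so its `i`-th coefficient is multiplied by `a` with
    -- no correction terms.
    rw [← coeff_smul_of_order a y i fun j hj => ih j hj (hj.trans hi)]
    exact h a ha i hi

theorem isTorsionFree (hN : F.IsTorsionFree N) : F.IsTorsionFree (Δ.Series N) := by
  intro L hL y hy
  ext n
  exact coeff_eq_zero_of_smul hN hL (fun a ha i _ => by rw [hy a ha, map_zero]) n n.lt_succ_self

/-- Successive approximation: if `y` represents `f` below degree `n`, the error has order at least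
`n`, so its `n`-th coefficient is a linear map to `N`. An element `z` representing that map corrects
`y` by `z tⁿ`. -/
theorem exists_coeff_eq_smul (hN : F.IsFilterInjective N) {L : Ideal Rᵐᵒᵖ} (hL : L ∈ F)
    (f : L →ₗ[Rᵐᵒᵖ] Δ.Series N) (n : ℕ) :
    ∃ y : Δ.Series N, ∀ a : L, ∀ i < n, coeff i (f a) = coeff i ((a : Rᵐᵒᵖ) • y) := by
  induction n with
  | zero => exact ⟨0, by simp⟩
  | succ n ih =>
    obtain ⟨y, hy⟩ := ih
    let g : L →ₗ[Rᵐᵒᵖ] Δ.Series N := f - (LinearMap.toSpanSingleton Rᵐᵒᵖ _ y) ∘ₗ L.subtype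
    have hg : ∀ a : L, f a = g a + (a : Rᵐᵒᵖ) • y := fun a => by simp [g]
    have hg0 : ∀ a : L, ∀ i < n, coeff i (g a) = 0 := fun a i hi => by
      have := hy a i hi
      rw [hg, map_add] at this
      simpa using this
    obtain ⟨z, hz⟩ := hN L hL
      { toFun := fun a => coeff n (g a)
        map_add' := fun a b => by rw [map_add, map_add]
        map_smul' := fun c a => by
          rw [map_smul, coeff_smul_of_order c _ n (hg0 a), RingHom.id_apply] }
    let w : Δ.Series N := mk (Pi.single n z)
    have hw : ∀ i < n, coeff i w = 0 := fun i hi => by simp [w, hi.ne]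
    refine ⟨y + w, fun a i hi => ?_⟩
    rw [hg, smul_add, map_add, map_add, add_comm]
    congr 1
    rcases (Nat.lt_succ_iff.1 hi).lt_or_eq with hi | rfl
    · rw [hg0 a i hi, coeff_smul_of_order _ _ _ fun j hj => hw j (hj.trans hi), hw i hi, smul_zero]
    · rw [coeff_smul_of_order _ _ _ hw]
      simpa [w] using hz a

/-- Torsion-freeness forces the approximations to share their low coefficients, so they glue to a
single series. -/
theorem isFilterInjective (hN : F.IsTorsionFree N) (hN' : F.IsFilterInjective N) :
    F.IsFilterInjective (Δ.Series N) := by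
  intro L hL f
  choose Y hY using exists_coeff_eq_smul hN' hL f
  have hcompat : ∀ n, ∀ i < n, coeff i (Y n) = coeff i (Y (i + 1)) := by
    intro n i hi
    rw [← sub_eq_zero, ← map_sub]
    refine coeff_eq_zero_of_smul hN hL (n := i + 1) (fun a ha j hj => ?_) i i.lt_succ_self
    rw [smul_sub, map_sub, ← hY n ⟨a, ha⟩ j (by omega), ← hY (i + 1) ⟨a, ha⟩ j hj, sub_self]
  -- `Y (i + 1)` is the first approximation that controls the coefficient of degree `i`.
  refine ⟨mk fun i => coeff i (Y (i + 1)), fun a => ext fun n => ?_⟩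
  rw [hY (n + 1) a n n.lt_succ_self]
  exact coeff_smul_congr _ fun i hi => hcompat _ i (Nat.lt_succ_iff.2 hi)

end Series

/-! ### Higher derivations as linear maps to series, and their extensions -/

namespace OnModule

variable {Δ} {M : Type v} [AddCommGroup M] [Module Rᵐᵒᵖ M]

@[ext] theorem ext {D D' : Δ.OnModule M} (h : ∀ n m, D.d n m = D'.d n m) : D = D' := by
  cases D
  cases D'
  congr
  funext n
  exact AddMonoidHom.ext (h n)

/-- The linear map `m ↦ ∑ dₙ(m) tⁿ` of a higher derivation. -/
def toSeries (D : Δ.OnModule M) : M →ₗ[Rᵐᵒᵖ] Δ.Series M where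
  toFun m := Series.mk fun n => D.d n m
  map_add' x y := by ext n; simp
  map_smul' a m := Series.ext fun n => D.map_smul n m a.unop

@[simp] theorem coeff_toSeries (D : Δ.OnModule M) (n : ℕ) (m : M) :
    Series.coeff n (D.toSeries m) = D.d n m := rfl

/-- The higher derivation of a linear map to series which is a section of the constant
coefficient. -/
def ofSeries (f : M →ₗ[Rᵐᵒᵖ] Δ.Series M) (hf : Series.constantCoeff ∘ₗ f = LinearMap.id) :
    Δ.OnModule M where
  d n := (Series.coeff n).comp f.toAddMonoidHom
  zero_eq := AddMonoidHom.ext fun m => LinearMap.congr_fun hf m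
  map_smul n m r := by
    change Series.coeff n (f (op r • m)) = _
    rw [_root_.map_smul, Series.coeff_smul]
    rfl

variable (F : IdealFilter Rᵐᵒᵖ) [F.IsGabriel]

/-- The series of `D`, pushed to `M_F`, lifts to a linear map on `M_F`. Its constant coefficient is
the identity because it is so on the image of `M`. Any other extension has a series with the same
restriction to `M`, hence the same series. -/
theorem existsUnique_isExtension (D : Δ.OnModule M) :
    ∃! D' : Δ.OnModule (F.ModuleOfQuotients M), D.IsExtension F D' := by
  have hQ := F.isTorsionFree_moduleOfQuotients M
  have hS := Series.isTorsionFree (Δ := Δ) hQ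
  obtain ⟨f, hf⟩ := IdealFilter.exists_lift hS
    (Series.isFilterInjective hQ (F.isFilterInjective_moduleOfQuotients M))
    (Series.map (F.toQuotients M) ∘ₗ D.toSeries)
  have hfn : ∀ n m, Series.coeff n (f (F.toQuotients M m)) = F.toQuotients M (D.d n m) :=
    fun n m => congrArg (Series.coeff n) (hf m)
  have hf0 : Series.constantCoeff ∘ₗ f = LinearMap.id := hQ.hom_ext fun m => by
    have := hfn 0 m
    rw [D.zero_eq] at this
    exact this
  refine ⟨ofSeries f hf0, hfn, fun D' hD' => ?_⟩
  have h : D'.toSeries = f := hS.hom_ext fun m => Series.ext fun n => by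
    rw [hfn]
    exact hD' n m
  ext1 n x
  rw [← coeff_toSeries, h]
  rfl

theorem extensionsAgree {F₁ F₂ : IdealFilter Rᵐᵒᵖ} [F₁.IsGabriel] [F₂.IsGabriel] (h : F₁ ≤ F₂)
    (D : Δ.OnModule M) : D.ExtensionsAgree h := by
  refine ⟨D.existsUnique_isExtension F₁, D.existsUnique_isExtension F₂,
    fun D₁ D₂ h₁ h₂ n x => ?_⟩
  -- Torsion-freeness for `F₂` passes to the smaller filter `F₁`, so maps out of `M_{F₁}` can be
  -- compared on `M`.
  have hS : F₁.IsTorsionFree (Δ.Series (F₂.ModuleOfQuotients M)) :=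
    (Series.isTorsionFree (F₂.isTorsionFree_moduleOfQuotients M)).anti h
  have hq : ∀ m, IdealFilter.quotientsMap M h (F₁.toQuotients M m) = F₂.toQuotients M m :=
    LinearMap.congr_fun (IdealFilter.quotientsMap_comp M h)
  have key : Series.map (IdealFilter.quotientsMap M h) ∘ₗ D₁.toSeries =
      D₂.toSeries ∘ₗ IdealFilter.quotientsMap M h := hS.hom_ext fun m => Series.ext fun k => by
    change IdealFilter.quotientsMap M h (D₁.d k _) = D₂.d k (IdealFilter.quotientsMap M h _)
    rw [h₁, hq, hq, h₂]
  exact congrArg (Series.coeff n) (LinearMap.congr_fun key x)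

end OnModule

end HigherDerivation

/-! ### Faithful torsion theories -/

namespace HereditaryTorsionTheory

variable {A : Type u} [Ring A] {τ : HereditaryTorsionTheory A}

theorem isTorsion_range {M N : Type u} [AddCommGroup M] [Module A M] [AddCommGroup N] [Module A N]
    (hM : τ.IsTorsion M) (g : M →ₗ[A] N) : τ.IsTorsion (LinearMap.range g) := by
  refine (τ.isTorsion_iff _).2 fun P _ _ hP f => ?_
  have h := (τ.isTorsion_iff M).1 hM P hP (f ∘ₗ g.rangeRestrict)
  ext ⟨_, x, rfl⟩
  exact LinearMap.congr_fun h x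

/-- For a faithful torsion theory, the ring is torsion-free for the associated filter. -/
theorem isTorsionFree_filter (hτ : τ.IsFaithful) : τ.filter.IsTorsionFree A := by
  intro I hI a ha
  -- The range is the left ideal `A a`, torsion as an image of `A ⧸ I`, hence zero by faithfulness.
  let g : (A ⧸ I) →ₗ[A] A := Submodule.liftQ I (LinearMap.toSpanSingleton A A a)
    (fun b hb => ha b hb)
  have hle : LinearMap.range g ≤ ⊥ := hτ ▸ le_sSup (isTorsion_range ((τ.mem_filter I).1 hI) g)
  have hmem : (1 : A) • a ∈ (⊥ : Submodule A A) := hle ⟨Submodule.Quotient.mk 1, rfl⟩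
  simpa using hmem

/-- If `f(1) ≠ 0`, essentiality gives a nonzero multiple `b • f(1)` equal to the image of some `a`
in the ring. Then `(I : b)` kills `a`, against torsion-freeness of the ring. -/
theorem filter_le_lambek (hτ : τ.IsFaithful) : τ.filter ≤ (lambek A).filter := by
  intro I hI
  refine ((lambek A).mem_filter I).2 fun f => ?_
  have hE := InjectiveEnvelope.isInjectiveEnvelope A A
  ext
  change f (Submodule.Quotient.mk 1) = 0
  by_contra h0
  obtain ⟨b, hb0, a, ha⟩ := (Submodule.isEssential_iff _).1 hE.essential _ h0
  refine hb0 ?_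
  rw [← ha, isTorsionFree_filter hτ (I.colon {b}) (IdealFilter.IsUniform.colon_mem hI b) a,
    map_zero]
  intro c hc
  refine (map_eq_zero_iff _ hE.mono).1 ?_
  rw [map_smul, ha, ← mul_smul, ← map_smul, ← Submodule.Quotient.mk_smul, smul_eq_mul, mul_one,
    (Submodule.Quotient.mk_eq_zero I).2 (by simpa using hc), map_zero]

/-- The annihilator of `f(1)` contains `I` and is essential: if it met `A a` trivially with `a ≠ 0`,
then `(I : a)` would kill `a`. Nonsingularity gives `f(1) = 0`. -/
theorem filter_le_goldie (hτ : τ.IsFaithful) : τ.filter ≤ (goldie A).filter := by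
  intro I hI
  refine ((goldie A).mem_filter I).2 fun N _ _ hN f => ?_
  ext
  refine hN _ ((Submodule.isEssential_iff _).2 fun a ha => ?_)
  by_contra! hcon
  refine ha (isTorsionFree_filter hτ (I.colon {a}) (IdealFilter.IsUniform.colon_mem hI a) a
    fun c hc => ?_)
  by_contra hca
  refine hcon c hca ?_
  rw [Submodule.mem_colon_singleton]
  change (c • a) • f (Submodule.Quotient.mk 1) = 0
  rw [← map_smul, ← Submodule.Quotient.mk_smul, smul_eq_mul, mul_one,
    (Submodule.Quotient.mk_eq_zero I).2 (by simpa using hc), map_zero]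

end HereditaryTorsionTheory

theorem mainTheorem4 {R : Type u} [Ring R] (Δ : HigherDerivation R) :
    (∀ (F₁ F₂ : IdealFilter Rᵐᵒᵖ) [F₁.IsGabriel] [F₂.IsGabriel] (h : F₁ ≤ F₂)
      (M : Type v) [AddCommGroup M] [Module Rᵐᵒᵖ M] (D : Δ.OnModule M),
      D.ExtensionsAgree h) ∧
    (∀ τ : HereditaryTorsionTheory Rᵐᵒᵖ, τ.IsFaithful →
      (∃ h : τ.filter ≤ (HereditaryTorsionTheory.lambek Rᵐᵒᵖ).filter,
        ∀ (M : Type v) [AddCommGroup M] [Module Rᵐᵒᵖ M] (D : Δ.OnModule M),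
          D.ExtensionsAgree h) ∧
      (∃ h : τ.filter ≤ (HereditaryTorsionTheory.goldie Rᵐᵒᵖ).filter,
        ∀ (M : Type v) [AddCommGroup M] [Module Rᵐᵒᵖ M] (D : Δ.OnModule M),
          D.ExtensionsAgree h)) := by
  exact ⟨fun _ _ _ _ h _ _ _ D => D.extensionsAgree h, fun _ hτ =>
    ⟨⟨HereditaryTorsionTheory.filter_le_lambek hτ, fun _ _ _ D => D.extensionsAgree _⟩,
      ⟨HereditaryTorsionTheory.filter_le_goldie hτ, fun _ _ _ D => D.extensionsAgree _⟩⟩⟩
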